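/- Let $q,k>1$ be integers. A table with $n$ attributes and domains of size $q$ is a finite set $R$ of rows in $\{1,\dots,q\}^n$. A set $K\subseteq\{1,\dots,n\}$ of attributes is a key for $R$ if any two rows of $R$ that agree in all coordinates of $K$ are equal, and a minimal key if moreover no proper subset of $K$ is a key. Let $f(q,k)$ denote the maximum $n$ for which there is such a table whose minimal keys are exactly the $k$-element subsets of $\{1,\dots,n\}$ (equivalently, the maximum $n$ for which there is a $q$-ary code of length $n$ with minimum Hamming distance at least $n-k+1$ such that for every set of $k-1$ coordinates some two codewords agree in exactly those coordinates). **Proposition.** $f(3,3)=7$ and $f(4,3)\in\{10,11\}$. -/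

import Mathlib

/-- A table with `n` attributes, all of whose domains have size `q`:
a finite set of data items (rows), each an `n`-tuple with entries from `q` symbols. -/
abbrev Table (q n : ℕ) : Type := Finset (Fin n → Fin q)

/-- The functional dependency `X → y`: no two rows of `R` agree in `X` but differ in `y`. -/
def FunctionallyDepends {q n : ℕ} (R : Table q n) (X : Finset (Fin n)) (y : Fin n) : Prop :=
  ∀ d ∈ R, ∀ e ∈ R, (∀ x ∈ X, d x = e x) → d y = e y

/-- `K` is a key for `R`: every attribute depends on `K`. -/
def IsKey {q n : ℕ} (R : Table q n) (K : Finset (Fin n)) : Prop :=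
  ∀ b : Fin n, FunctionallyDepends R K b

/-- `K` is a minimal key for `R`: it is a key, and no proper subset of `K` is a key. -/
def IsMinimalKey {q n : ℕ} (R : Table q n) (K : Finset (Fin n)) : Prop :=
  IsKey R K ∧ ∀ L : Finset (Fin n), L ⊂ K → ¬ IsKey R L

/-- `R` is an Armstrong instance for the collection of all `k`-subsets of the attribute set
being the system of minimal keys: the minimal keys for `R` are exactly the `k`-subsets. -/
def IsArmstrongInstance {q n : ℕ} (k : ℕ) (R : Table q n) : Prop :=
  ∀ K : Finset (Fin n), IsMinimalKey R K ↔ K.card = k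

/-- The set of all `n` for which such an instance with domains of size `q` exists;
`f(q, k)` is the greatest element of this set. -/
def armstrongLengths (q k : ℕ) : Set ℕ :=
  {n | ∃ R : Table q n, IsArmstrongInstance k R}

/-!
A table with `n > k` attributes is an Armstrong instance for the `(k + 1)`-subsets exactly when
two distinct rows never agree in more than `k` attributes and every `k`-set of attributes is the
set of all agreements of some pair of rows (`isArmstrongInstance_succ_iff`). The lower bounds are
then explicit tables: 7 rows of length 7 over three symbols and 11 rows of length 10 over four.

For the upper bounds let `k = 2` and let `M` be the number of rows. Counting the (ordered) row pairs
that agree in two given attributes yields `n ≤ M` (`IsTwoAgreement.length_le_card`), since each pair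
of attributes needs a row pair of its own. Counting the agreements attribute by attribute, with
Cauchy–Schwarz on the sizes of the symbol classes, yields Plotkin's inequality
`n * M ≤ q * (n + 2 * (M - 1))` (`IsTwoAgreement.plotkin`). For `q = 4` the two exclude `n ≥ 12`,
for `q = 3` they exclude `n ≥ 9` and leave `M ∈ {8, 9}` for `n = 8`.

In these two cases Plotkin's count is tight, so that every attribute splits the rows into classes of
sizes `3, 3, 2` or `3, 3, 3`, and any two rows agree in exactly two attributes. There are then
attributes `x ≠ y` and rows `d ≠ e` such that `{d, e}` is the only row pair agreeing in both `x`
and `y`, and such that all classes of `x` other than that of `d` have size three. Each of those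
classes meets every class of `y`, so the class of `d` in `y` has at least four rows
(`succ_le_card_symbolClass_of_unique_pair`), a contradiction.
-/

open Finset

/-! ### Armstrong instances in terms of agreement sets -/

/-- The set of attributes in which the rows `d` and `e` agree. -/
def agreeSet {q n : ℕ} (d e : Fin n → Fin q) : Finset (Fin n) :=
  univ.filter fun x => d x = e x

@[simp] lemma mem_agreeSet {q n : ℕ} {d e : Fin n → Fin q} {x : Fin n} :
    x ∈ agreeSet d e ↔ d x = e x := by
  simp [agreeSet]

lemma isKey_iff {q n : ℕ} {R : Table q n} {K : Finset (Fin n)} :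
    IsKey R K ↔ ∀ d ∈ R, ∀ e ∈ R, K ⊆ agreeSet d e → d = e := by
  constructor
  · intro h d hd e he hK
    funext b
    exact h b d hd e he fun x hx => mem_agreeSet.1 (hK hx)
  · intro h b d hd e he hK
    rw [h d hd e he fun x hx => mem_agreeSet.2 (hK x hx)]

lemma IsKey.mono {q n : ℕ} {R : Table q n} {K L : Finset (Fin n)} (hK : IsKey R K)
    (h : K ⊆ L) : IsKey R L :=
  fun b d hd e he hL => hK b d hd e he fun x hx => hL x (h hx)

theorem isArmstrongInstance_succ_iff {q n k : ℕ} (hkn : k < n) {R : Table q n} :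
    IsArmstrongInstance (k + 1) R ↔
      (∀ d ∈ R, ∀ e ∈ R, d ≠ e → #(agreeSet d e) ≤ k) ∧
        ∀ P : Finset (Fin n), #P = k → ∃ d ∈ R, ∃ e ∈ R, d ≠ e ∧ agreeSet d e = P := by
  constructor
  · intro h
    have hle : ∀ d ∈ R, ∀ e ∈ R, d ≠ e → #(agreeSet d e) ≤ k := by
      intro d hd e he hde
      by_contra! hlt
      obtain ⟨K, hK, hcard⟩ := exists_subset_card_eq (Nat.succ_le_of_lt hlt)
      exact hde (isKey_iff.1 ((h K).2 hcard).1 d hd e he hK)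
    refine ⟨hle, fun P hP => ?_⟩
    obtain ⟨y, hy⟩ : ∃ y, y ∉ P := by
      by_contra! hall
      have : P = univ := eq_univ_iff_forall.2 hall
      simp [this] at hP
      omega
    have hnot := ((h (insert y P)).2 (by rw [card_insert_of_notMem hy, hP])).2 P
      (ssubset_insert hy)
    simp only [isKey_iff, not_forall] at hnot
    obtain ⟨d, hd, e, he, hPs, hde⟩ := hnot
    exact ⟨d, hd, e, he, hde,
      (eq_of_subset_of_card_le hPs (by rw [hP]; exact hle d hd e he hde)).symm⟩
  · rintro ⟨hle, hex⟩ K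
    have key_of_card : ∀ L : Finset (Fin n), #L = k + 1 → IsKey R L := by
      intro L hL
      refine isKey_iff.2 fun d hd e he hLs => ?_
      by_contra hde
      have := hle d hd e he hde
      have := card_le_card hLs
      omega
    have card_of_key : ∀ L : Finset (Fin n), IsKey R L → k + 1 ≤ #L := by
      intro L hL
      by_contra! hlt
      obtain ⟨P, hLP, -, hP⟩ := exists_subsuperset_card_eq (subset_univ L)
        (Nat.le_of_lt_succ hlt) (by simpa using hkn.le)
      obtain ⟨d, hd, e, he, hde, rfl⟩ := hex P hP
      exact hde (isKey_iff.1 hL d hd e he hLP)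
    constructor
    · rintro ⟨hK, hmin⟩
      obtain ⟨L, hLK, hL⟩ := exists_subset_card_eq (card_of_key K hK)
      rcases hLK.eq_or_ssubset with rfl | hss
      · exact hL
      · exact absurd (key_of_card L hL) (hmin L hss)
    · intro hK
      refine ⟨key_of_card K hK, fun L hL hkey => ?_⟩
      have := card_of_key L hkey
      have := card_lt_card hL
      omega

/-! ### Explicit tables -/

lemma mem_armstrongLengths_three_of_rows {q n m : ℕ} (hn : 2 < n) (row : Fin m → Fin n → Fin q)
    (hle : ∀ i j, i < j → #(agreeSet (row i) (row j)) ≤ 2)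
    (hex : ∀ x y, x < y → ∃ i j, i < j ∧ row i x = row j x ∧ row i y = row j y) :
    n ∈ armstrongLengths q 3 := by
  have hle' : ∀ i j, i ≠ j → #(agreeSet (row i) (row j)) ≤ 2 := by
    intro i j hij
    rcases lt_or_gt_of_ne hij with h | h
    · exact hle i j h
    · simpa only [agreeSet, eq_comm] using hle j i h
  refine ⟨univ.image row, (isArmstrongInstance_succ_iff hn).2 ⟨?_, fun P hP => ?_⟩⟩
  · simp only [mem_image, mem_univ, true_and]
    rintro _ ⟨i, rfl⟩ _ ⟨j, rfl⟩ hij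
    exact hle' i j fun h => hij (h ▸ rfl)
  · have hne : ∀ i j, i < j → row i ≠ row j := by
      intro i j hij h
      have := hle i j hij
      simp [h, agreeSet] at this
      omega
    have main : ∀ x y, x < y → ∃ d ∈ univ.image row, ∃ e ∈ univ.image row,
        d ≠ e ∧ agreeSet d e = {x, y} := by
      intro x y hxy
      obtain ⟨i, j, hij, hx, hy⟩ := hex x y hxy
      refine ⟨row i, by simp, row j, by simp, hne i j hij, ?_⟩
      refine (eq_of_subset_of_card_le ?_ ?_).symm
      · simp [insert_subset_iff, hx, hy]
      · rw [card_pair hxy.ne]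
        exact hle i j hij
    obtain ⟨x, y, hxy, rfl⟩ := card_eq_two.1 hP
    rcases lt_or_gt_of_ne hxy with h | h
    · exact main x y h
    · rw [pair_comm]
      exact main y x h

theorem seven_mem_armstrongLengths : 7 ∈ armstrongLengths 3 3 :=
  mem_armstrongLengths_three_of_rows (by norm_num)
    ![![0, 2, 1, 0, 2, 2, 1],
      ![1, 1, 2, 0, 0, 2, 0],
      ![2, 1, 1, 2, 1, 2, 2],
      ![2, 0, 2, 0, 2, 0, 2],
      ![2, 2, 1, 1, 0, 0, 0],
      ![0, 2, 2, 2, 0, 1, 2],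
      ![0, 1, 0, 2, 2, 0, 0]]
    (by decide +kernel) (by decide +kernel)

theorem ten_mem_armstrongLengths : 10 ∈ armstrongLengths 4 3 :=
  mem_armstrongLengths_three_of_rows (by norm_num)
    ![![3, 1, 0, 3, 0, 2, 0, 2, 3, 1],
      ![0, 1, 2, 3, 3, 1, 1, 3, 1, 3],
      ![0, 2, 3, 3, 1, 3, 2, 0, 3, 2],
      ![2, 2, 1, 2, 0, 0, 1, 3, 3, 0],
      ![3, 2, 1, 1, 3, 2, 3, 0, 0, 3],
      ![2, 0, 2, 2, 1, 2, 2, 1, 1, 1],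
      ![2, 3, 1, 3, 2, 3, 0, 1, 2, 3],
      ![1, 1, 0, 0, 1, 3, 1, 1, 0, 0],
      ![0, 0, 0, 1, 2, 0, 1, 0, 2, 1],
      ![1, 3, 2, 1, 2, 1, 2, 2, 3, 0],
      ![2, 3, 0, 0, 0, 1, 3, 0, 1, 2]]
    (by decide +kernel) (by decide +kernel)

/-! ### Counting agreements -/

/-- Any two distinct rows agree in at most two attributes, and any two attributes are the
agreement set of some two rows. -/
structure IsTwoAgreement {q n : ℕ} (R : Table q n) : Prop where
  card_le : ∀ d ∈ R, ∀ e ∈ R, d ≠ e → #(agreeSet d e) ≤ 2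
  exists_pair : ∀ x y : Fin n, x ≠ y → ∃ d ∈ R, ∃ e ∈ R, d ≠ e ∧ agreeSet d e = {x, y}

lemma IsArmstrongInstance.isTwoAgreement {q n : ℕ} {R : Table q n} (hn : 2 < n)
    (h : IsArmstrongInstance 3 R) : IsTwoAgreement R :=
  have h' := (isArmstrongInstance_succ_iff hn).1 h
  ⟨h'.1, fun _ _ hxy => h'.2 _ (card_pair hxy)⟩

/-- The rows of `R` that have the symbol `s` in attribute `x`. -/
def symbolClass {q n : ℕ} (R : Table q n) (x : Fin n) (s : Fin q) : Table q n :=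
  R.filter fun r => r x = s

/-- The ordered pairs of distinct rows that agree in attribute `x`. -/
def agreePairs {q n : ℕ} (R : Table q n) (x : Fin n) :
    Finset ((Fin n → Fin q) × (Fin n → Fin q)) :=
  R.offDiag.filter fun p => p.1 x = p.2 x

/-- The ordered pairs of distinct rows that agree in both attributes `x` and `y`. -/
def agreePairs₂ {q n : ℕ} (R : Table q n) (x y : Fin n) :
    Finset ((Fin n → Fin q) × (Fin n → Fin q)) :=
  R.offDiag.filter fun p => p.1 x = p.2 x ∧ p.1 y = p.2 y

section Counting

variable {q n : ℕ} {R : Table q n}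

lemma sum_card_symbolClass (R : Table q n) (x : Fin n) : ∑ s, #(symbolClass R x s) = #R :=
  (card_eq_sum_card_fiberwise fun _ _ => mem_univ _).symm

lemma card_agreePairs_add_card (R : Table q n) (x : Fin n) :
    #(agreePairs R x) + #R = ∑ s, #(symbolClass R x s) ^ 2 := by
  have h1 : #((R ×ˢ R).filter fun p => p.1 x = p.2 x) = ∑ s, #(symbolClass R x s) ^ 2 := by
    rw [card_eq_sum_card_fiberwise (f := fun p => p.1 x) (t := univ) fun _ _ => mem_univ _]
    refine sum_congr rfl fun s _ => ?_
    rw [sq, ← card_product]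
    congr 1
    ext ⟨d, e⟩
    simp only [symbolClass, mem_filter, mem_product]
    constructor
    · rintro ⟨⟨⟨hd, he⟩, h⟩, hs⟩
      exact ⟨⟨hd, hs⟩, he, h ▸ hs⟩
    · rintro ⟨⟨hd, hs⟩, he, hs'⟩
      exact ⟨⟨⟨hd, he⟩, hs.trans hs'.symm⟩, hs⟩
  rw [← h1, ← diag_union_offDiag, filter_union,
    card_union_of_disjoint (disjoint_filter_filter (disjoint_diag_offDiag R)), add_comm]
  congr 1
  rw [← diag_card R]
  congr 1
  symm
  refine filter_true_of_mem fun p hp => ?_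
  rw [(mem_diag.1 hp).2]

/-- Cauchy–Schwarz: the rows agreeing in `x` are fewest when the symbols are equidistributed. -/
lemma card_sq_le (R : Table q n) (x : Fin n) :
    #R ^ 2 ≤ q * (#(agreePairs R x) + #R) := by
  have := sq_sum_le_card_mul_sum_sq (s := univ) (f := fun s => #(symbolClass R x s))
  rwa [sum_card_symbolClass, card_univ, Fintype.card_fin, ← card_agreePairs_add_card] at this

lemma sum_card_agreePairs (R : Table q n) :
    ∑ x, #(agreePairs R x) = ∑ p ∈ R.offDiag, #(agreeSet p.1 p.2) :=
  (sum_card_bipartiteAbove_eq_sum_card_bipartiteBelow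
    (fun (p : (Fin n → Fin q) × (Fin n → Fin q)) (x : Fin n) => p.1 x = p.2 x)).symm

lemma sum_card_agreePairs₂ (R : Table q n) :
    ∑ z ∈ univ.offDiag, #(agreePairs₂ R z.1 z.2) =
      ∑ p ∈ R.offDiag, #(agreeSet p.1 p.2).offDiag := by
  have := (sum_card_bipartiteAbove_eq_sum_card_bipartiteBelow (s := R.offDiag)
    (t := (univ : Finset (Fin n)).offDiag)
    (fun p z => p.1 z.1 = p.2 z.1 ∧ p.1 z.2 = p.2 z.2)).symm
  refine this.trans (sum_congr rfl fun p _ => ?_)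
  congr 1
  ext z
  simp only [bipartiteAbove, mem_filter, mem_offDiag, mem_univ, mem_agreeSet]
  tauto

/-! ### Bounds for tables with two agreements -/

namespace IsTwoAgreement

lemma card_agreeSet_le (h : IsTwoAgreement R) {p : (Fin n → Fin q) × (Fin n → Fin q)}
    (hp : p ∈ R.offDiag) : #(agreeSet p.1 p.2) ≤ 2 := by
  obtain ⟨hd, he, hne⟩ := mem_offDiag.1 hp
  exact h.card_le _ hd _ he hne

lemma sum_card_agreePairs_le (h : IsTwoAgreement R) :
    ∑ x, #(agreePairs R x) ≤ #R.offDiag * 2 := by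
  rw [sum_card_agreePairs]
  exact sum_le_card_nsmul _ _ _ fun p hp => h.card_agreeSet_le hp

lemma sum_card_agreePairs₂_le (h : IsTwoAgreement R) :
    ∑ z ∈ univ.offDiag, #(agreePairs₂ R z.1 z.2) ≤ #R.offDiag * 2 := by
  rw [sum_card_agreePairs₂]
  refine sum_le_card_nsmul _ _ _ fun p hp => ?_
  have := h.card_agreeSet_le hp
  rw [offDiag_card]
  interval_cases #(agreeSet p.1 p.2) <;> simp

lemma exists_agreePairs₂ (h : IsTwoAgreement R) {x y : Fin n} (hxy : x ≠ y) :
    ∃ d e, d ≠ e ∧ {(d, e), (e, d)} ⊆ agreePairs₂ R x y := by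
  obtain ⟨d, hd, e, he, hne, hP⟩ := h.exists_pair x y hxy
  have hx : x ∈ agreeSet d e := by simp [hP]
  have hy : y ∈ agreeSet d e := by simp [hP]
  rw [mem_agreeSet] at hx hy
  refine ⟨d, e, hne, ?_⟩
  simp [insert_subset_iff, agreePairs₂, hd, he, hne, hne.symm, hx, hy]

lemma two_le_card_agreePairs₂ (h : IsTwoAgreement R) {x y : Fin n} (hxy : x ≠ y) :
    2 ≤ #(agreePairs₂ R x y) := by
  obtain ⟨d, e, hne, hsub⟩ := h.exists_agreePairs₂ hxy
  have := card_le_card hsub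
  rwa [card_pair fun h => hne (Prod.ext_iff.1 h).1] at this

lemma card_offDiag_le (h : IsTwoAgreement R) :
    #(univ : Finset (Fin n)).offDiag ≤ #R.offDiag := by
  have h1 : #(univ : Finset (Fin n)).offDiag * 2 ≤
      ∑ z ∈ univ.offDiag, #(agreePairs₂ R z.1 z.2) :=
    card_nsmul_le_sum _ _ _ fun z hz => h.two_le_card_agreePairs₂ (mem_offDiag.1 hz).2.2
  have := h1.trans h.sum_card_agreePairs₂_le
  omega

lemma length_le_card (h : IsTwoAgreement R) (hn : 2 ≤ n) : n ≤ #R := by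
  have h1 := h.card_offDiag_le
  simp only [offDiag_card, card_univ, Fintype.card_fin, ← Nat.mul_sub_one] at h1
  by_contra! hlt
  have h2 : #R * (#R - 1) ≤ (n - 1) * (n - 1) := Nat.mul_le_mul (by omega) (by omega)
  have h3 : (n - 1) * (n - 1) < n * (n - 1) := Nat.mul_lt_mul_of_pos_right (by omega) (by omega)
  omega

lemma plotkin (h : IsTwoAgreement R) (hR : 0 < #R) :
    n * #R ≤ q * (n + 2 * (#R - 1)) := by
  have h1 : ∑ _x : Fin n, #R ^ 2 ≤ ∑ x, q * (#(agreePairs R x) + #R) :=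
    sum_le_sum fun x _ => card_sq_le R x
  rw [← mul_sum, sum_add_distrib] at h1
  simp only [sum_const, card_univ, Fintype.card_fin, smul_eq_mul] at h1
  have h2 := h.sum_card_agreePairs_le
  rw [offDiag_card, ← Nat.mul_sub_one] at h2
  refine Nat.le_of_mul_le_mul_right ?_ hR
  calc n * #R * #R = n * #R ^ 2 := by ring
    _ ≤ q * (∑ x, #(agreePairs R x) + n * #R) := h1
    _ ≤ q * (#R * (#R - 1) * 2 + n * #R) := by gcongr
    _ = q * (n + 2 * (#R - 1)) * #R := by ring

end IsTwoAgreement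

/-! ### A pair of rows that alone agrees in two attributes -/

/-- If `{d, e}` is the only row pair that agrees in both `x` and `y`, a class of `x` other than that
of `d` has distinct symbols in `y`, hence, having `q` rows, all symbols. -/
theorem succ_le_card_symbolClass_of_unique_pair {x y : Fin n} {d e : Fin n → Fin q}
    (hde : (d, e) ∈ agreePairs₂ R x y) (huniq : agreePairs₂ R x y ⊆ {(d, e), (e, d)})
    (hclass : ∀ s ≠ d x, q ≤ #(symbolClass R x s)) :
    q + 1 ≤ #(symbolClass R y (d y)) := by
  simp only [agreePairs₂, mem_filter, mem_offDiag] at hde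
  obtain ⟨⟨hd, he, hne⟩, hx, hy⟩ := hde
  have hfib : #(symbolClass R y (d y)) =
      ∑ s, #((symbolClass R y (d y)).filter fun r => r x = s) :=
    card_eq_sum_card_fiberwise fun _ _ => mem_univ _
  have h2 : 2 ≤ #((symbolClass R y (d y)).filter fun r => r x = d x) := by
    rw [← card_pair hne]
    refine card_le_card ?_
    simp [insert_subset_iff, symbolClass, hd, he, hx, hy]
  have h1 : ∀ s ∈ univ.erase (d x),
      1 ≤ #((symbolClass R y (d y)).filter fun r => r x = s) := by
    intro s hs
    have hs : s ≠ d x := ne_of_mem_erase hs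
    have hinj : Set.InjOn (fun r : Fin n → Fin q => r y) (symbolClass R x s) := by
      intro r hr r' hr' hrr
      simp only [symbolClass, coe_filter, Set.mem_ofPred_eq] at hr hr'
      by_contra hrne
      have hmem : (r, r') ∈ agreePairs₂ R x y :=
        mem_filter.2 ⟨mem_offDiag.2 ⟨hr.1, hr'.1, hrne⟩, hr.2.trans hr'.2.symm, hrr⟩
      have := huniq hmem
      simp only [mem_insert, mem_singleton, Prod.mk.injEq] at this
      rcases this with h | h
      · exact hs (by rw [← hr.2, h.1])
      · exact hs (by rw [← hr.2, h.1, hx])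
    have hsurj : (symbolClass R x s).image (fun r => r y) = univ := by
      rw [← card_eq_iff_eq_univ, card_image_of_injOn hinj, Fintype.card_fin]
      refine le_antisymm ?_ (hclass s hs)
      rw [← card_image_of_injOn hinj]
      simpa using card_le_univ ((symbolClass R x s).image fun r => r y)
    obtain ⟨r, hr, hry⟩ := mem_image.1 (hsurj ▸ mem_univ (d y))
    simp only [symbolClass, mem_filter] at hr
    refine card_pos.2 ⟨r, ?_⟩
    simp [symbolClass, hr.1, hr.2, hry]
  rw [hfib, ← add_sum_erase _ _ (mem_univ (d x))]
  have h3 := card_nsmul_le_sum _ _ _ h1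
  rw [card_erase_of_mem (mem_univ _), card_univ, Fintype.card_fin, smul_eq_mul, mul_one] at h3
  omega

end Counting

/-! ### Three symbols and eight attributes -/

lemma two_lt_card_agreePairs₂ {n : ℕ} {R : Table 3 n} {x y : Fin n} {d e : Fin n → Fin 3}
    (hde : (d, e) ∈ agreePairs₂ R x y) (hx : ∀ s ≠ d x, 3 ≤ #(symbolClass R x s))
    (hy : ∀ s, #(symbolClass R y s) ≤ 3) : 2 < #(agreePairs₂ R x y) := by
  by_contra! hle
  have hde' := hde
  simp only [agreePairs₂, mem_filter, mem_offDiag] at hde'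
  obtain ⟨⟨hd, he, hne⟩, h1, h2⟩ := hde'
  have hsub : {(d, e), (e, d)} ⊆ agreePairs₂ R x y := by
    simp [insert_subset_iff, agreePairs₂, hd, he, hne, hne.symm, h1, h2]
  have heq := eq_of_subset_of_card_le hsub
    (by rwa [card_pair fun h => hne (Prod.ext_iff.1 h).1])
  have := succ_le_card_symbolClass_of_unique_pair hde heq.ge hx
  have := hy (d y)
  omega

lemma card_symbolClass_of_card_nine {n : ℕ} {R : Table 3 n} (hR : #R = 9) {x : Fin n}
    (hx : #(agreePairs R x) ≤ 18) (s : Fin 3) : #(symbolClass R x s) = 3 := by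
  have h1 := sum_card_symbolClass R x
  have h2 := card_agreePairs_add_card R x
  rw [Fin.sum_univ_three] at h1 h2
  have h3 : ∀ a b c : ℕ, a + b + c = 9 → a ^ 2 + b ^ 2 + c ^ 2 ≤ 27 → a = 3 ∧ b = 3 ∧ c = 3 := by
    intro a b c hs hq
    have ha : a ≤ 5 := by nlinarith
    have hb : b ≤ 5 := by nlinarith
    obtain rfl : c = 9 - a - b := by omega
    interval_cases a <;> interval_cases b <;> simp_all
  have := h3 _ _ _ (h1.trans hR) (by omega)
  fin_cases s
  exacts [this.1, this.2.1, this.2.2]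

lemma card_symbolClass_of_card_eight {n : ℕ} {R : Table 3 n} (hR : #R = 8) {x : Fin n}
    (hx : #(agreePairs R x) ≤ 14) :
    (∀ s, #(symbolClass R x s) ≤ 3) ∧
      ∃ t, #(symbolClass R x t) = 2 ∧ ∀ s ≠ t, 3 ≤ #(symbolClass R x s) := by
  have h1 := sum_card_symbolClass R x
  have h2 := card_agreePairs_add_card R x
  rw [Fin.sum_univ_three] at h1 h2
  have h3 : ∀ a b c : ℕ, a + b + c = 8 → a ^ 2 + b ^ 2 + c ^ 2 ≤ 22 →
      a = 2 ∧ b = 3 ∧ c = 3 ∨ a = 3 ∧ b = 2 ∧ c = 3 ∨ a = 3 ∧ b = 3 ∧ c = 2 := by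
    intro a b c hs hq
    have ha : a ≤ 4 := by nlinarith
    have hb : b ≤ 4 := by nlinarith
    obtain rfl : c = 8 - a - b := by omega
    interval_cases a <;> interval_cases b <;> simp_all
  have h4 := h3 _ _ _ (h1.trans hR) (by omega)
  simp only [Fin.forall_fin_succ, Fin.exists_fin_succ]
  rcases h4 with h | h | h <;> simp [h]

/-- A bound from below on each term turns a matching bound on a sum into one on each term. -/
lemma le_of_sum_le_card_mul {ι : Type*} {s : Finset ι} {f : ι → ℕ} {c : ℕ}
    (hge : ∀ i ∈ s, c ≤ f i) (hsum : ∑ i ∈ s, f i ≤ #s * c) {i : ι} (hi : i ∈ s) : f i ≤ c := by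
  classical
  have h1 : #(s.erase i) • c ≤ ∑ j ∈ s.erase i, f j :=
    card_nsmul_le_sum _ _ _ fun j hj => hge j (mem_of_mem_erase hj)
  rw [card_erase_of_mem hi, smul_eq_mul, Nat.sub_one_mul] at h1
  have h2 : f i + ∑ j ∈ s.erase i, f j = ∑ j ∈ s, f j := add_sum_erase s f hi
  have h3 : c ≤ #s * c := Nat.le_mul_of_pos_left c (card_pos.2 ⟨i, hi⟩)
  omega

lemma not_isTwoAgreement_of_card_nine {R : Table 3 8} (hR : #R = 9) : ¬ IsTwoAgreement R := by
  intro h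
  have hoff : #R.offDiag = 72 := by rw [offDiag_card, hR]
  have hS : ∀ x, #(agreePairs R x) ≤ 18 := fun x =>
    le_of_sum_le_card_mul (s := univ) (f := fun x => #(agreePairs R x))
      (fun x _ => by have := card_sq_le R x; rw [hR] at this; omega)
      (by simpa [hoff] using h.sum_card_agreePairs_le) (mem_univ x)
  -- The 144 coincidences cannot supply three for each of the 56 ordered pairs of attributes.
  obtain ⟨⟨x, y⟩, hz, hlt⟩ : ∃ z ∈ (univ : Finset (Fin 8)).offDiag,
      #(agreePairs₂ R z.1 z.2) < 3 := by
    refine exists_lt_of_sum_lt ?_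
    have := h.sum_card_agreePairs₂_le
    rw [hoff] at this
    refine this.trans_lt ?_
    simp [offDiag_card]
  have hxy : x ≠ y := (mem_offDiag.1 hz).2.2
  obtain ⟨d, e, -, hsub⟩ := h.exists_agreePairs₂ hxy
  have hgt := two_lt_card_agreePairs₂ (hsub (mem_insert_self _ _))
    (fun s _ => (card_symbolClass_of_card_nine hR (hS x) s).ge)
    (fun s => (card_symbolClass_of_card_nine hR (hS y) s).le)
  exact hgt.not_ge (Nat.le_of_lt_succ hlt)

lemma not_isTwoAgreement_of_card_eight {R : Table 3 8} (hR : #R = 8) : ¬ IsTwoAgreement R := by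
  intro h
  have hoff : #R.offDiag = 56 := by rw [offDiag_card, hR]
  -- Cauchy–Schwarz only gives `64 / 3 - 8`, which integrality rounds up to `14`.
  have hge : ∀ x, 14 ≤ #(agreePairs R x) := fun x => by
    have := card_sq_le R x
    rw [hR] at this
    omega
  have hS : ∀ x, #(agreePairs R x) ≤ 14 := fun x =>
    le_of_sum_le_card_mul (s := univ) (f := fun x => #(agreePairs R x)) (fun x _ => hge x)
      (by simpa [hoff] using h.sum_card_agreePairs_le) (mem_univ x)
  have hN : ∀ x y : Fin 8, x ≠ y → #(agreePairs₂ R x y) ≤ 2 := fun x y hxy =>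
    le_of_sum_le_card_mul (s := univ.offDiag) (f := fun z => #(agreePairs₂ R z.1 z.2))
      (fun z hz => h.two_le_card_agreePairs₂ (mem_offDiag.1 hz).2.2)
      (by have := h.sum_card_agreePairs₂_le; rw [hoff] at this; simpa [offDiag_card] using this)
      (i := (x, y)) (by simpa using hxy)
  -- The two rows `d`, `e` of the small class of attribute `0` agree in a second attribute.
  obtain ⟨-, t, ht, hbig⟩ := card_symbolClass_of_card_eight hR (hS 0)
  obtain ⟨d, e, hne, hcl⟩ := card_eq_two.1 ht
  have hd : d ∈ symbolClass R 0 t := by simp [hcl]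
  have he : e ∈ symbolClass R 0 t := by simp [hcl]
  simp only [symbolClass, mem_filter] at hd he
  have hagree : 1 < #(agreeSet d e) := by
    by_contra! hlt
    have hp : (d, e) ∈ R.offDiag := mem_offDiag.2 ⟨hd.1, he.1, hne⟩
    have h1 : ∑ p ∈ R.offDiag, #(agreeSet p.1 p.2) < ∑ _p ∈ R.offDiag, 2 :=
      sum_lt_sum (fun p hp => h.card_agreeSet_le hp) ⟨_, hp, Nat.lt_succ_of_le hlt⟩
    have h2 := card_nsmul_le_sum univ (fun x => #(agreePairs R x)) 14 fun x _ => hge x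
    rw [sum_card_agreePairs] at h2
    simp [hoff] at h1 h2
    omega
  obtain ⟨y, hy, hy0⟩ := exists_mem_ne hagree 0
  rw [mem_agreeSet] at hy
  refine (hN 0 y hy0.symm).not_gt (two_lt_card_agreePairs₂ (d := d) (e := e) ?_ ?_
    (card_symbolClass_of_card_eight hR (hS y)).1)
  · simp [agreePairs₂, hd.1, he.1, hne, hd.2, he.2, hy]
  · rw [hd.2]
    exact hbig

/-! ### The greatest lengths -/

lemma le_seven_of_mem_armstrongLengths {n : ℕ} (hn : n ∈ armstrongLengths 3 3) : n ≤ 7 := by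
  obtain ⟨R, hR⟩ := hn
  by_contra! hlt
  have h := hR.isTwoAgreement (by omega)
  have hM := h.length_le_card (by omega)
  have hP := h.plotkin (by omega)
  obtain ⟨m, hm⟩ : ∃ m, #R = m + 1 := ⟨#R - 1, by omega⟩
  rw [hm, Nat.add_sub_cancel] at hP
  -- Plotkin's inequality now reads `(n - 6) * (#R - 3) ≤ 12`.
  obtain rfl : n = 8 := by
    by_contra hne
    have h9 : 9 ≤ n := by omega
    have hm' : 8 ≤ m := by omega
    nlinarith
  have : #R = 8 ∨ #R = 9 := by omega
  rcases this with h8 | h9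
  · exact not_isTwoAgreement_of_card_eight h8 h
  · exact not_isTwoAgreement_of_card_nine h9 h

lemma le_eleven_of_mem_armstrongLengths {n : ℕ} (hn : n ∈ armstrongLengths 4 3) : n ≤ 11 := by
  obtain ⟨R, hR⟩ := hn
  by_contra! hlt
  have h := hR.isTwoAgreement (by omega)
  have hM := h.length_le_card (by omega)
  have hP := h.plotkin (by omega)
  obtain ⟨m, hm⟩ : ∃ m, #R = m + 1 := ⟨#R - 1, by omega⟩
  rw [hm, Nat.add_sub_cancel] at hP
  have hm' : 11 ≤ m := by omega
  -- Plotkin's inequality now reads `(n - 8) * (#R - 4) ≤ 24`.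
  nlinarith

theorem mainTheorem8 :
    IsGreatest (armstrongLengths 3 3) 7 ∧
      (IsGreatest (armstrongLengths 4 3) 10 ∨ IsGreatest (armstrongLengths 4 3) 11) := by
  refine ⟨⟨seven_mem_armstrongLengths, fun n hn => le_seven_of_mem_armstrongLengths hn⟩, ?_⟩
  by_cases h : 11 ∈ armstrongLengths 4 3
  · exact Or.inr ⟨h, fun n hn => le_eleven_of_mem_armstrongLengths hn⟩
  · refine Or.inl ⟨ten_mem_armstrongLengths, fun n hn => ?_⟩
    have hle := le_eleven_of_mem_armstrongLengths hn
    have hne : n ≠ 11 := fun h' => h (h' ▸ hn)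
    omega
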